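/- Let $n,p\ge 0$ be integers and $J_m=\begin{bmatrix}0&I_m\\-I_m&0\end{bmatrix}\in\mathbb R^{2m\times 2m}$. For $A\in\mathbb R^{2n\times 2p}$ let $A^+=J_p^TA^TJ_n$ be its symplectic inverse, let $\operatorname{SpSt}(2n,2p)=\{U\in\mathbb R^{2n\times 2p}\mid U^+U=I_{2p}\}$ be the symplectic Stiefel manifold, an embedded smooth submanifold of $\mathbb R^{2n\times 2p}$, with tangent spaces (the velocities at $U$ of smooth curves in $\operatorname{SpSt}(2n,2p)$ through $U$) $$T_U\operatorname{SpSt}(2n,2p)=\{D\in\mathbb R^{2n\times 2p}\mid (J_pU^+D)^T=J_pU^+D\},$$ and let $T\operatorname{SpSt}(2n,2p)=\{(U,D)\mid U\in\operatorname{SpSt}(2n,2p),\ D\in T_U\operatorname{SpSt}(2n,2p)\}$ be the tangent bundle. The principal square root of a real square matrix $A$ is the unique real matrix $A^{1/2}$ that squares to $A$ and has all its complex eigenvalues in the open right half-plane. For $U,D\in\mathbb R^{2n\times 2p}$ put $$\Delta=U\exp_m(U^+D)+(I-UU^+)D,\qquad K=\Delta^TJ_n\Delta,\qquad G_f=\bigl((-KJ_p)^{-1/2}\bigr)^T,\qquad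 R^f_U(D)=\Delta\,G_f ,$$ and let $\mathcal D$ be the set of all $(U,D)\in T\operatorname{SpSt}(2n,2p)$ such that $-KJ_p$ has no eigenvalue in $(-\infty,0]$. Theorem. $\operatorname{SpSt}(2n,2p)$ is an embedded smooth submanifold of $\mathbb R^{2n\times 2p}$ with the tangent spaces displayed above. For every $(U,D)\in\mathcal D$ the principal square root of $-KJ_p$ exists and is unique, so that $R^f_U(D)$ is well defined on $\mathcal D$. The maps $R^f_U$ constitute a retraction on $\operatorname{SpSt}(2n,2p)$ with domain $\mathcal D$, that is: 1. $\mathcal D$ is relatively open in $T\operatorname{SpSt}(2n,2p)$ and contains $(U,0)$ for every $U\in\operatorname{SpSt}(2n,2p)$; 2. $R^f_U(D)\in\operatorname{SpSt}(2n,2p)$ for all $(U,D)\in\mathcal D$; 3. $(U,D)\mapsto R^f_U(D)$ is smooth ($C^\infty$) on $\mathcal D$, jointly in $U$ and $D$; 4. $R^f_U(0)=U$ for all $U\in\operatorname{SpSt}(2n,2p)$; 5. the differential of $R^f_U$ at $0$, as a map defined near $0$ on $T_U\operatorname{SpSt}(2n,2p)$, is the identity: $d(R^f_U)_0[D]=D$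 for all $U\in\operatorname{SpSt}(2n,2p)$ and $D\in T_U\operatorname{SpSt}(2n,2p)$. -/

import Mathlib

open scoped Matrix ContDiff

-- Any norm on the finite-dimensional matrix spaces gives the same notions; we fix one.
attribute [local instance] Matrix.linftyOpNormedAddCommGroup Matrix.linftyOpNormedSpace

namespace SymplecticStiefel

section Submanifolds

variable {E F : Type*} [NormedAddCommGroup E] [NormedSpace ℝ E]
  [NormedAddCommGroup F] [NormedSpace ℝ F]

/-- `M` is an embedded smooth submanifold (of some constant codimension `k`) of the linear space
`E`: near each of its points it is the zero set of a smooth `ℝᵏ`-valued function whose differential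
at that point is surjective. -/
def IsEmbeddedSubmanifold (M : Set E) : Prop :=
  ∃ k : ℕ, ∀ x ∈ M, ∃ (O : Set E) (h : E → EuclideanSpace ℝ (Fin k)),
    IsOpen O ∧ x ∈ O ∧ ContDiffOn ℝ ∞ h O ∧ Function.Surjective (fderiv ℝ h x) ∧
      ∀ y ∈ O, y ∈ M ↔ h y = 0

/-- The tangent space `T_x M` of a submanifold `M` of `E`: all velocities `c'(0)` of smooth curves
`c : (-ε, ε) → M` with `c(0) = x`. -/
def tangentSpaceAt (M : Set E) (x : E) : Set E :=
  {v | ∃ (c : ℝ → E) (ε : ℝ), 0 < ε ∧ ContDiffOn ℝ ∞ c (Set.Ioo (-ε) ε) ∧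
    (∀ t ∈ Set.Ioo (-ε) ε, c t ∈ M) ∧ c 0 = x ∧ HasDerivAt c v 0}

/-- The tangent bundle `TM = {(x, v) | x ∈ M, v ∈ T_x M}`, as a subset of `E × E`. -/
def tangentBundleSet (M : Set E) : Set (E × E) :=
  {q | q.1 ∈ M ∧ q.2 ∈ tangentSpaceAt M q.1}

/-- Smoothness of a map on a subset `S` of a linear space (in particular on a submanifold):
near every point of `S` the map coincides on `S` with a smooth map on an open set. -/
def IsSmoothOnSubset (f : E → F) (S : Set E) : Prop :=
  ∀ x ∈ S, ∃ (O : Set E) (g : E → F),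
    IsOpen O ∧ x ∈ O ∧ ContDiffOn ℝ ∞ g O ∧ ∀ y ∈ S ∩ O, f y = g y

/-- `R`, with `R x v` standing for `R_x(v)`, is a retraction on the submanifold `M` of `E` with
domain of definition `𝒟`, an open neighbourhood of the zero section in the tangent bundle. -/
structure IsRetractionOn (M : Set E) (𝒟 : Set (E × E)) (R : E → E → E) : Prop where
  /-- The domain is a (relatively) open subset of the tangent bundle. -/
  open_domain : ∃ O : Set (E × E), IsOpen O ∧ 𝒟 = tangentBundleSet M ∩ O
  /-- The domain contains the zero section. -/
  zero_mem : ∀ x ∈ M, (x, (0 : E)) ∈ 𝒟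
  /-- `R` takes values in `M`. -/
  maps_to : ∀ q ∈ 𝒟, R q.1 q.2 ∈ M
  /-- `R` is smooth jointly in the base point and the tangent vector. -/
  smooth : IsSmoothOnSubset (fun q : E × E => R q.1 q.2) 𝒟
  /-- `R_x(0) = x`. -/
  map_zero : ∀ x ∈ M, R x 0 = x
  /-- The differential at `0` of `R_x`, a map defined near `0` in `T_x M`, is the identity of
  `T_x M`. -/
  differential_zero : ∀ x ∈ M,
    HasFDerivWithinAt (R x) (ContinuousLinearMap.id ℝ E) (tangentSpaceAt M x) 0

end Submanifolds

/-- The structure matrix `J_n = [0, I; -I, 0]` of size `2n`; `Fin n ⊕ Fin n` indexes the two blocks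
of `n` rows (columns). -/
def J (n : ℕ) : Matrix (Fin n ⊕ Fin n) (Fin n ⊕ Fin n) ℝ :=
  Matrix.fromBlocks 0 1 (-1) 0

/-- Real `2n × 2p` matrices. -/
abbrev Mat (n p : ℕ) : Type := Matrix (Fin n ⊕ Fin n) (Fin p ⊕ Fin p) ℝ

/-- The symplectic inverse `A⁺ = J_pᵀ Aᵀ J_n` of a `2n × 2p` matrix. -/
def sympInv {n p : ℕ} (A : Mat n p) : Mat p n := (J p)ᵀ * Aᵀ * J n

/-- The symplectic Stiefel manifold `SpSt(2n, 2p) = {U | U⁺ U = I}`. -/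
def SpSt (n p : ℕ) : Set (Mat n p) := {U | sympInv U * U = 1}

/-- Hamiltonian matrices `𝔰𝔭(2p, ℝ) = {Ω | (J_p Ω)ᵀ = J_p Ω}`. -/
def hamiltonian (p : ℕ) : Set (Mat p p) := {Ω | (J p * Ω)ᵀ = J p * Ω}

/-- `S` is a principal square root of the real matrix `A`: `S² = A`, and all complex eigenvalues of
`S` lie in the open right half-plane. -/
def IsPrincipalSqrt {p : ℕ} (A S : Mat p p) : Prop :=
  S * S = A ∧ ∀ z ∈ spectrum ℂ (S.map (fun r : ℝ => (r : ℂ))), 0 < z.re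

open Classical in
/-- The principal square root of a real matrix (`0` if there is none). -/
noncomputable def principalSqrt {p : ℕ} (A : Mat p p) : Mat p p :=
  if h : ∃ S, IsPrincipalSqrt A S then h.choose else 0

/-- `Δ = U exp_m(U⁺ D) + (I - U U⁺) D`. -/
noncomputable def Delta {n p : ℕ} (U D : Mat n p) : Mat n p :=
  U * NormedSpace.exp (sympInv U * D) + (1 - U * sympInv U) * D

/-- `K = Δᵀ J_n Δ`. -/
noncomputable def K {n p : ℕ} (U D : Mat n p) : Mat p p :=
  (Delta U D)ᵀ * J n * Delta U D

/-- `G_f = ((-K J_p)^{-1/2})ᵀ`, with the principal square root. -/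
noncomputable def Gf {n p : ℕ} (U D : Mat n p) : Mat p p :=
  ((principalSqrt (-(K U D * J p)))⁻¹)ᵀ

/-- `R^f_U(D) = (U exp_m(U⁺ D) + (I - U U⁺) D) G_f`. -/
noncomputable def Rf {n p : ℕ} (U D : Mat n p) : Mat n p := Delta U D * Gf U D

/-- The natural domain of `(U, D) ↦ R^f_U(D)` in the tangent bundle of `SpSt(2n, 2p)`: the matrix
`-K J_p` has no eigenvalue in `(-∞, 0]`. -/
def domainRf (n p : ℕ) : Set (Mat n p × Mat n p) :=
  {q | q ∈ tangentBundleSet (SpSt n p) ∧ ∀ r ∈ spectrum ℝ (-(K q.1 q.2 * J p)), 0 < r}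

end SymplecticStiefel

/-!
Every real matrix `A` without eigenvalues in `(-∞, 0]` has a unique principal square root
(`exists_isPrincipalSqrt_iff`, `IsPrincipalSqrt.unique`). For existence over `ℂ`, a polynomial `f`
with `χ_A ∣ f² - X` that takes the principal values `√μ` at the eigenvalues is evaluated at `A`
(`exists_polynomial_sq_sub_X`). Uniqueness follows from Sylvester's theorem: if `S² = T²`, then
`S (S - T) + (S - T) T = 0`, and `S` and `-T` have no common eigenvalue. Uniqueness shows that the
root of a real matrix is real. The differential `H ↦ S H + H S` of squaring is injective for the
same reason, so that by the inverse function theorem the principal square root is smooth, on an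
open set (`contDiffAt_principalSqrt`, `isOpen_setOf_spectrum_pos`).

The symplectic Stiefel manifold is the set `Uᵀ J U = J`. Since `K = Δᵀ J Δ` is skew-symmetric,
uniqueness gives the symmetry `J Sᵀ = S J` of `S = (-K J)^{1/2}`. Hence `S J Sᵀ = S² J = K`, so
`Rᵀ J R = S⁻¹ K S⁻ᵀ = J` for `R = Δ S⁻ᵀ` (`Rf_mem_SpSt`). The differential of `D ↦ Δ` at `0` is the
identity, and that of `D ↦ -K J` vanishes on the matrices `D` with `Dᵀ J U + Uᵀ J D = 0`, so
`t ↦ R_U(t D)` has velocity `D` at `0` (`hasDerivAt_Rf`). This is the differential required of a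
retraction, and it also shows that every such `D` is the velocity of a curve in the manifold
(`tangentSpaceAt_SpSt`).
-/

namespace SymplecticStiefel

/-! ### Principal square roots -/

section PrincipalSquareRoots

open Polynomial

variable {ι : Type*} [Fintype ι] [DecidableEq ι]

/-- Hermite interpolation of the principal branch of `√` at the points of `s`, with multiplicity.
The inductive step corrects an interpolant `f` for `s` by a multiple of `∏ (X - ν)`, either to
prescribe the value at a new point, or to raise the order of vanishing of `f² - X` at an old one,
which is possible because `f` does not vanish there. -/
theorem exists_polynomial_sq_sub_X (s : Multiset ℂ) (hs : ∀ μ ∈ s, μ ∈ Complex.slitPlane) :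
    ∃ f : ℂ[X], (s.map fun μ => X - C μ).prod ∣ f ^ 2 - X ∧
      ∀ μ ∈ s, f.eval μ = μ ^ (1 / 2 : ℂ) := by
  induction s using Multiset.induction with
  | empty => exact ⟨0, by simp, by simp⟩
  | cons μ s ih =>
    obtain ⟨f, ⟨g, hg⟩, hf⟩ := ih fun ν hν => hs ν (Multiset.mem_cons_of_mem hν)
    set P := (s.map fun μ => X - C μ).prod with hP
    have hroot : ∀ ν ∈ s, P.eval ν = 0 := fun ν hν => by
      rw [hP, eval_multiset_prod, Multiset.map_map]
      exact Multiset.prod_eq_zero (Multiset.mem_map.2 ⟨ν, hν, by simp⟩)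
    have hμ0 : μ ≠ 0 := Complex.slitPlane_ne_zero (hs μ (Multiset.mem_cons_self μ s))
    have hsq : (μ ^ (1 / 2 : ℂ)) ^ 2 = μ := by
      simp
    have hne : μ ^ (1 / 2 : ℂ) ≠ 0 := fun h => hμ0 (by rw [← hsq, h]; simp)
    obtain ⟨c, hc1, hc2⟩ : ∃ c : ℂ, (f + C c * P).eval μ = μ ^ (1 / 2 : ℂ) ∧
        (g + 2 * C c * f + C c ^ 2 * P).eval μ = 0 := by
      by_cases h0 : μ ∈ s
      · refine ⟨-g.eval μ / (2 * μ ^ (1 / 2 : ℂ)), by simp [hroot μ h0, hf μ h0], ?_⟩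
        simp only [eval_add, eval_mul, eval_C, eval_pow, hroot μ h0, hf μ h0, eval_ofNat]
        field_simp
        ring
      · have hPμ : P.eval μ ≠ 0 := by
          rw [hP, eval_multiset_prod, Multiset.map_map]
          refine Multiset.prod_ne_zero fun h => ?_
          obtain ⟨ν, hν, h⟩ := Multiset.mem_map.1 h
          have : μ = ν := by simpa [sub_eq_zero] using h
          exact h0 (this ▸ hν)
        have h1 : (f + C ((μ ^ (1 / 2 : ℂ) - f.eval μ) / P.eval μ) * P).eval μ
            = μ ^ (1 / 2 : ℂ) := by
          simp only [eval_add, eval_mul, eval_C]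
          field_simp
          ring
        refine ⟨_, h1, mul_left_cancel₀ hPμ ?_⟩
        generalize (μ ^ (1 / 2 : ℂ) - f.eval μ) / P.eval μ = c at h1
        have h2 : P * (g + 2 * C c * f + C c ^ 2 * P) = (f + C c * P) ^ 2 - X := by
          linear_combination -hg
        rw [← eval_mul, h2, eval_sub, eval_pow, h1, hsq]
        simp
    refine ⟨f + C c * P, ?_, fun ν hν => ?_⟩
    · obtain ⟨k, hk⟩ := dvd_iff_isRoot.2 hc2
      rw [Multiset.map_cons, Multiset.prod_cons]
      exact ⟨k, by linear_combination hg + P * hk⟩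
    · rcases Multiset.mem_cons.1 hν with rfl | hν
      · exact hc1
      · simp [hroot ν hν, hf ν hν]

/-- The principal branch of the square root takes values in the open right half-plane. -/
theorem re_cpow_half_pos {μ : ℂ} (hμ : μ ∈ Complex.slitPlane) : 0 < (μ ^ (1 / 2 : ℂ)).re := by
  have hμ0 := Complex.slitPlane_ne_zero hμ
  rw [Complex.cpow_def_of_ne_zero hμ0, Complex.exp_re]
  have him : (Complex.log μ * (1 / 2)).im = Complex.arg μ / 2 := by
    have : Complex.log μ * (1 / 2) = (Complex.log μ) / (2 : ℝ) := by push_cast; ring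
    rw [this, Complex.div_ofReal_im, Complex.log_im]
  rw [him]
  have h1 := Complex.neg_pi_lt_arg μ
  have h2 := lt_of_le_of_ne (Complex.arg_le_pi μ) (Complex.mem_slitPlane_iff_arg.1 hμ).1
  exact mul_pos (Real.exp_pos _) (Real.cos_pos_of_mem_Ioo ⟨by linarith, by linarith⟩)

/-- A complex matrix without eigenvalues in `(-∞, 0]` has a principal square root: evaluate at `A`
a polynomial `f` that interpolates `√` at the eigenvalues and for which `χ_A ∣ f² - X`. -/
theorem exists_complex_principalSqrt (A : Matrix ι ι ℂ)
    (hA : spectrum ℂ A ⊆ Complex.slitPlane) :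
    ∃ S : Matrix ι ι ℂ, S * S = A ∧ ∀ z ∈ spectrum ℂ S, 0 < z.re := by
  -- Spectral mapping needs a nonempty spectrum, so matrices of size `0` are treated separately.
  cases isEmpty_or_nonempty ι
  · exact ⟨0, Subsingleton.elim _ _, fun z hz => by
      simp [spectrum.of_subsingleton] at hz⟩
  have hspec : ∀ μ, μ ∈ A.charpoly.roots ↔ μ ∈ spectrum ℂ A := fun μ => by
    rw [Matrix.mem_spectrum_iff_isRoot_charpoly, mem_roots A.charpoly_monic.ne_zero]
  obtain ⟨f, hdvd, hf⟩ := exists_polynomial_sq_sub_X A.charpoly.roots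
    fun μ hμ => hA ((hspec μ).1 hμ)
  rw [← (IsAlgClosed.splits A.charpoly).eq_prod_roots_of_monic A.charpoly_monic] at hdvd
  refine ⟨aeval A f, ?_, fun z hz => ?_⟩
  · obtain ⟨g, hg⟩ := hdvd
    have h := congrArg (aeval A) hg
    rw [map_mul, Matrix.aeval_self_charpoly, zero_mul, map_sub, map_pow, aeval_X, sub_eq_zero] at h
    rw [← sq, h]
  · rw [spectrum.map_polynomial_aeval_of_nonempty A f
      (spectrum.nonempty_of_isAlgClosed_of_finiteDimensional ℂ A)] at hz
    obtain ⟨μ, hμ, rfl⟩ := hz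
    simp only [hf μ ((hspec μ).2 hμ)]
    exact re_cpow_half_pos (hA hμ)

/-- Sylvester's theorem: `A Y = Y B` has only the zero solution if `A` and `B` have no common
eigenvalue. Indeed `0 = χ_A(A) Y = Y χ_A(B)`, and `χ_A(B)` is invertible. -/
theorem eq_zero_of_mul_eq_mul_of_disjoint_spectrum {A B Y : Matrix ι ι ℂ}
    (h : A * Y = Y * B) (hd : ∀ z ∈ spectrum ℂ A, z ∉ spectrum ℂ B) : Y = 0 := by
  have hpoly : ∀ f : ℂ[X], aeval A f * Y = Y * aeval B f := fun f => by
    induction f using Polynomial.induction_on' with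
    | add f g hf hg => rw [map_add, map_add, add_mul, mul_add, hf, hg]
    | monomial n a =>
      have hpow : A ^ n * Y = Y * B ^ n := (show SemiconjBy Y B A from h.symm).pow_right n |>.symm
      rw [aeval_monomial, aeval_monomial, mul_assoc, hpow, ← mul_assoc, ← mul_assoc,
        Algebra.commutes]
  cases isEmpty_or_nonempty ι
  · exact Subsingleton.elim _ _
  have hunit : IsUnit (aeval B A.charpoly) := by
    rw [← spectrum.zero_notMem_iff ℂ, spectrum.map_polynomial_aeval_of_nonempty B _
      (spectrum.nonempty_of_isAlgClosed_of_finiteDimensional ℂ B)]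
    rintro ⟨z, hz, h0⟩
    exact hd z (Matrix.mem_spectrum_iff_isRoot_charpoly.2 h0) hz
  have h0 := hpoly A.charpoly
  rw [Matrix.aeval_self_charpoly, zero_mul] at h0
  exact (hunit.mul_left_eq_zero).1 h0.symm

theorem eq_zero_of_mul_add_mul_eq_zero {S T H : Matrix ι ι ℂ}
    (hS : ∀ z ∈ spectrum ℂ S, 0 < z.re) (hT : ∀ z ∈ spectrum ℂ T, 0 < z.re)
    (h : S * H + H * T = 0) : H = 0 := by
  refine eq_zero_of_mul_eq_mul_of_disjoint_spectrum (A := S) (B := -T)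
    (by rw [mul_neg]; exact eq_neg_of_add_eq_zero_left h) fun z hz hz' => ?_
  rw [← spectrum.neg_eq] at hz'
  have h1 := hS z hz
  have h2 := hT (-z) hz'
  rw [Complex.neg_re] at h2
  linarith

theorem complex_principalSqrt_unique {S T : Matrix ι ι ℂ} (h : S * S = T * T)
    (hS : ∀ z ∈ spectrum ℂ S, 0 < z.re) (hT : ∀ z ∈ spectrum ℂ T, 0 < z.re) : S = T :=
  sub_eq_zero.1 <| eq_zero_of_mul_add_mul_eq_zero hS hT <| by
    rw [mul_sub, sub_mul, h]; abel

/-- Entrywise inclusion of real into complex matrices, as a ring homomorphism. -/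
noncomputable def complexify : Matrix ι ι ℝ →+* Matrix ι ι ℂ := Complex.ofRealHom.mapMatrix

theorem complexify_injective : Function.Injective (complexify (ι := ι)) :=
  Matrix.map_injective Complex.ofReal_injective

theorem ofReal_mem_spectrum_complexify {A : Matrix ι ι ℝ} {r : ℝ} :
    (r : ℂ) ∈ spectrum ℂ (complexify A) ↔ r ∈ spectrum ℝ A := by
  rw [Matrix.mem_spectrum_iff_isRoot_charpoly, Matrix.mem_spectrum_iff_isRoot_charpoly, complexify,
    RingHom.mapMatrix_apply, Matrix.charpoly_map]
  exact Polynomial.isRoot_map_iff (f := Complex.ofRealHom) Complex.ofReal_injective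

theorem spectrum_complexify_eq_of_charpoly_eq {A B : Matrix ι ι ℝ} (h : A.charpoly = B.charpoly) :
    spectrum ℂ (complexify A) = spectrum ℂ (complexify B) := by
  ext z
  rw [Matrix.mem_spectrum_iff_isRoot_charpoly, Matrix.mem_spectrum_iff_isRoot_charpoly, complexify,
    RingHom.mapMatrix_apply, RingHom.mapMatrix_apply, Matrix.charpoly_map, Matrix.charpoly_map, h]

theorem conj_mem_spectrum_map_conj {A : Matrix ι ι ℂ} {z : ℂ}
    (hz : z ∈ spectrum ℂ ((starRingEnd ℂ).mapMatrix A)) : starRingEnd ℂ z ∈ spectrum ℂ A := by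
  rw [Matrix.mem_spectrum_iff_isRoot_charpoly] at hz ⊢
  rw [RingHom.mapMatrix_apply, Matrix.charpoly_map, ← Complex.conj_conj z] at hz
  exact (Polynomial.isRoot_map_iff (starRingEnd ℂ).injective).1 hz

variable {p : ℕ}

theorem isPrincipalSqrt_iff {A S : Mat p p} :
    IsPrincipalSqrt A S ↔ S * S = A ∧ ∀ z ∈ spectrum ℂ (complexify S), 0 < z.re :=
  Iff.rfl

theorem IsPrincipalSqrt.unique {A S T : Mat p p} (hS : IsPrincipalSqrt A S)
    (hT : IsPrincipalSqrt A T) : S = T :=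
  complexify_injective <| complex_principalSqrt_unique
    (by rw [← map_mul, ← map_mul, hS.1, hT.1]) hS.2 hT.2

/-- A real matrix has a principal square root exactly if it has no eigenvalue in `(-∞, 0]`. The
complex principal square root of a real matrix is real: by uniqueness it equals its conjugate. -/
theorem exists_isPrincipalSqrt_iff {A : Mat p p} :
    (∃ S, IsPrincipalSqrt A S) ↔ ∀ r ∈ spectrum ℝ A, 0 < r := by
  constructor
  · rintro ⟨S, rfl, hS⟩ r hr
    change ∀ z ∈ spectrum ℂ (complexify S), 0 < z.re at hS
    rw [← ofReal_mem_spectrum_complexify, map_mul, ← sq,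
      spectrum.map_pow_of_pos (𝕜 := ℂ) (complexify S) two_pos] at hr
    obtain ⟨z, hz, hzr⟩ := hr
    have hre := hS z hz
    have h1 := congrArg Complex.re hzr
    have h2 := congrArg Complex.im hzr
    simp only [sq, Complex.mul_re, Complex.mul_im, Complex.ofReal_re, Complex.ofReal_im] at h1 h2
    have him : z.im = 0 := by
      have : z.re * z.im = 0 := by linarith
      exact (mul_eq_zero.1 this).resolve_left hre.ne'
    rw [← h1, him]
    nlinarith
  · intro hA
    obtain ⟨S, hSA, hS⟩ := exists_complex_principalSqrt (complexify A) fun z hz => by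
      by_cases him : z.im = 0
      · have hz' : z = (z.re : ℂ) := Complex.ext rfl (by simpa using him)
        rw [hz', ofReal_mem_spectrum_complexify] at hz
        exact Or.inl (hA _ hz)
      · exact Or.inr him
    have hconj : (starRingEnd ℂ).mapMatrix S = S := by
      refine complex_principalSqrt_unique ?_ (fun z hz => ?_) hS
      · rw [← map_mul, hSA]
        ext i j
        simp [complexify]
      · have := hS _ (conj_mem_spectrum_map_conj hz)
        rwa [Complex.conj_re] at this
    have hreal : complexify (S.map Complex.re) = S := by
      ext i j
      have h := congrFun (congrFun hconj i) j
      simp only [RingHom.mapMatrix_apply, Matrix.map_apply] at h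
      simpa [complexify] using Complex.conj_eq_iff_re.1 h
    refine ⟨S.map Complex.re, isPrincipalSqrt_iff.2 ⟨complexify_injective ?_, ?_⟩⟩
    · rw [map_mul, hreal, hSA]
    · rwa [hreal]

theorem isPrincipalSqrt_principalSqrt {A : Mat p p} (hA : ∀ r ∈ spectrum ℝ A, 0 < r) :
    IsPrincipalSqrt A (principalSqrt A) := by
  have h := exists_isPrincipalSqrt_iff.2 hA
  rw [principalSqrt, dif_pos h]
  exact h.choose_spec

theorem IsPrincipalSqrt.principalSqrt_eq {A S : Mat p p} (h : IsPrincipalSqrt A S) :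
    principalSqrt A = S :=
  (isPrincipalSqrt_principalSqrt (exists_isPrincipalSqrt_iff.1 ⟨S, h⟩)).unique h

theorem IsPrincipalSqrt.isUnit {A S : Mat p p} (h : IsPrincipalSqrt A S) : IsUnit S := by
  rw [← spectrum.zero_notMem_iff ℝ, ← ofReal_mem_spectrum_complexify]
  intro h0
  have := h.2 _ h0
  simp at this

end PrincipalSquareRoots

/-! ### Smoothness of the principal square root -/

section Smoothness

-- Spectral semicontinuity, `exp` and inversion require the normed algebra structure. It extends the
-- norm fixed for the submanifold notions.
attribute [local instance] Matrix.linftyOpNormedRing Matrix.linftyOpNormedAlgebra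

variable {p : ℕ}

theorem isOpen_setOf_spectrum_re_pos :
    IsOpen {S : Mat p p | ∀ z ∈ spectrum ℂ (complexify S), 0 < z.re} := by
  have hcont : Continuous fun S : Mat p p => complexify S :=
    continuous_id.matrix_map Complex.continuous_ofReal
  have hopen : IsOpen {z : ℂ | 0 < z.re} := isOpen_lt continuous_const Complex.continuous_re
  rw [isOpen_iff_mem_nhds]
  intro S hS
  have h := upperHemicontinuous_spectrum ℂ (Matrix (Fin p ⊕ Fin p) (Fin p ⊕ Fin p) ℂ)
    (complexify S) _ (hopen.mem_nhdsSet.2 hS)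
  filter_upwards [hcont.continuousAt.eventually h] with T hT
  exact subset_of_mem_nhdsSet hT

/-- The differential `H ↦ S H + H S` of squaring at `S`. -/
noncomputable def sqDeriv (S : Mat p p) : Mat p p →L[ℝ] Mat p p :=
  ContinuousLinearMap.mul ℝ (Mat p p) S + (ContinuousLinearMap.mul ℝ (Mat p p)).flip S

theorem hasFDerivAt_mul_self (S : Mat p p) :
    HasFDerivAt (fun T : Mat p p => T * T) (sqDeriv S) S := by
  refine ((hasFDerivAt_id S).mul' (hasFDerivAt_id S)).congr_fderiv ?_
  ext1 H
  rfl

theorem sqDeriv_injective {S : Mat p p} (hS : ∀ z ∈ spectrum ℂ (complexify S), 0 < z.re) :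
    Function.Injective (sqDeriv S) := by
  rw [injective_iff_map_eq_zero]
  intro H hH
  refine complexify_injective ?_
  rw [map_zero]
  refine eq_zero_of_mul_add_mul_eq_zero hS hS ?_
  rw [← map_mul, ← map_mul, ← map_add, ← map_zero complexify]
  exact congrArg _ hH

/-- Near a matrix `A` without eigenvalues in `(-∞, 0]` the principal square root is the local
inverse of squaring given by the inverse function theorem. -/
theorem exists_local_principalSqrt {A : Mat p p} (hA : ∀ r ∈ spectrum ℝ A, 0 < r) :
    ∃ g : Mat p p → Mat p p, ContDiffAt ℝ ∞ g A ∧ ∀ᶠ B in nhds A, IsPrincipalSqrt B (g B) := by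
  obtain ⟨S, rfl, hS⟩ := exists_isPrincipalSqrt_iff.2 hA
  let e : Mat p p ≃L[ℝ] Mat p p :=
    (LinearEquiv.ofInjectiveEndo (sqDeriv S).toLinearMap
      (sqDeriv_injective hS)).toContinuousLinearEquiv
  have he : HasFDerivAt (fun T : Mat p p => T * T) (e : Mat p p →L[ℝ] Mat p p) S :=
    (hasFDerivAt_mul_self S).congr_fderiv (by ext1 H; rfl)
  have hsm : ContDiffAt ℝ ∞ (fun T : Mat p p => T * T) S := contDiffAt_id.mul contDiffAt_id
  have hstrict := hsm.hasStrictFDerivAt' he (by simp)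
  have hg := hsm.to_localInverse he (by simp)
  refine ⟨_, hg, ?_⟩
  have h0 : hsm.localInverse he (by simp) (S * S) = S :=
    hsm.localInverse_apply_image he (by simp)
  have hmem := hg.continuousAt.eventually_mem
    (s := {S : Mat p p | ∀ z ∈ spectrum ℂ (complexify S), 0 < z.re})
    (isOpen_setOf_spectrum_re_pos.mem_nhds (by rw [h0]; exact hS))
  filter_upwards [hmem, hstrict.eventually_right_inverse] with B h1 h2
  exact ⟨h2, h1⟩

theorem isOpen_setOf_spectrum_pos : IsOpen {A : Mat p p | ∀ r ∈ spectrum ℝ A, 0 < r} := by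
  rw [isOpen_iff_mem_nhds]
  intro A hA
  obtain ⟨g, -, hg⟩ := exists_local_principalSqrt hA
  filter_upwards [hg] with B hB
  exact exists_isPrincipalSqrt_iff.1 ⟨_, hB⟩

theorem contDiffAt_principalSqrt {A : Mat p p} (hA : ∀ r ∈ spectrum ℝ A, 0 < r) :
    ContDiffAt ℝ ∞ principalSqrt A := by
  obtain ⟨g, hg, hgA⟩ := exists_local_principalSqrt hA
  exact hg.congr_of_eventuallyEq (hgA.mono fun B hB => hB.principalSqrt_eq)

theorem contDiff_transpose {m n : Type*} [Fintype m] [Fintype n] :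
    ContDiff ℝ ∞ fun A : Matrix m n ℝ => Aᵀ :=
  (Matrix.transposeLinearEquiv m n ℝ ℝ).toLinearMap.toContinuousLinearMap.contDiff

/-- Matrix multiplication as a continuous bilinear map. -/
noncomputable def mulBilin (l m n : Type*) [Fintype l] [Fintype m] [Fintype n] :
    Matrix l m ℝ →L[ℝ] Matrix m n ℝ →L[ℝ] Matrix l n ℝ :=
  (LinearMap.toContinuousLinearMap.toLinearMap ∘ₗ
    (LinearMap.mk₂ ℝ (fun (A : Matrix l m ℝ) (B : Matrix m n ℝ) => A * B) Matrix.add_mul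
      (fun c A B => Matrix.smul_mul c A B) Matrix.mul_add
      (fun c A B => Matrix.mul_smul A c B))).toContinuousLinearMap

theorem _root_.ContDiffAt.matrix_mul {E : Type*} [NormedAddCommGroup E] [NormedSpace ℝ E]
    {l m n : Type*} [Fintype l] [Fintype m] [Fintype n] {f : E → Matrix l m ℝ}
    {g : E → Matrix m n ℝ} {x : E} (hf : ContDiffAt ℝ ∞ f x) (hg : ContDiffAt ℝ ∞ g x) :
    ContDiffAt ℝ ∞ (fun y => f y * g y) x :=
  ContDiffAt.comp x (g := fun q : Matrix l m ℝ × Matrix m n ℝ => q.1 * q.2)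
    (mulBilin l m n).isBoundedBilinearMap.contDiff.contDiffAt (hf.prodMk hg)

theorem contDiffAt_transpose_inv_principalSqrt {A : Mat p p} (hA : ∀ r ∈ spectrum ℝ A, 0 < r) :
    ContDiffAt ℝ ∞ (fun B : Mat p p => ((principalSqrt B)⁻¹)ᵀ) A := by
  obtain ⟨u, hu⟩ := (isPrincipalSqrt_principalSqrt hA).isUnit
  have hinv : ContDiffAt ℝ ∞ (fun B : Mat p p => B⁻¹) (principalSqrt A) := by
    simp_rw [Matrix.nonsing_inv_eq_ringInverse]
    rw [← hu]
    exact contDiffAt_ringInverse ℝ u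
  exact contDiff_transpose.contDiffAt.comp A (hinv.comp A (contDiffAt_principalSqrt hA))

theorem contDiff_exp : ContDiff ℝ ∞ (NormedSpace.exp : Mat p p → Mat p p) :=
  contDiff_iff_contDiffAt.2 fun A => (NormedSpace.exp_analytic (𝕂 := ℝ) A).contDiffAt

theorem hasFDerivAt_matrix_exp_zero :
    HasFDerivAt (NormedSpace.exp : Mat p p → Mat p p) (ContinuousLinearMap.id ℝ (Mat p p)) 0 :=
  hasFDerivAt_exp_zero

end Smoothness

/-! ### The symplectic form and the symplectic Stiefel manifold -/

section SymplecticAlgebra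

variable {n p : ℕ}

theorem J_transpose (n : ℕ) : (J n)ᵀ = -J n := by
  simp [J, Matrix.fromBlocks_transpose, Matrix.fromBlocks_neg]

theorem J_mul_J (n : ℕ) : J n * J n = -1 := by
  simp [J, Matrix.fromBlocks_multiply, ← Matrix.fromBlocks_one, Matrix.fromBlocks_neg]

theorem sympInv_mul (U : Mat n p) {l : Type*} (D : Matrix (Fin n ⊕ Fin n) l ℝ) :
    sympInv U * D = -(J p * (Uᵀ * J n * D)) := by
  simp only [sympInv, J_transpose, Matrix.neg_mul, Matrix.mul_assoc]

theorem J_mul_J_mul {l : Type*} (M : Matrix (Fin n ⊕ Fin n) l ℝ) : J n * (J n * M) = -M := by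
  rw [← Matrix.mul_assoc, J_mul_J, Matrix.neg_mul, Matrix.one_mul]

theorem mem_SpSt_iff {U : Mat n p} : U ∈ SpSt n p ↔ Uᵀ * J n * U = J p := by
  change sympInv U * U = 1 ↔ _
  rw [sympInv_mul]
  constructor
  · intro h
    have h1 := congrArg (J p * ·) h
    simpa only [Matrix.mul_neg, J_mul_J_mul, neg_neg, Matrix.mul_one] using h1
  · intro h
    rw [h, J_mul_J, neg_neg]

theorem sympInv_mul_mem_hamiltonian_iff {U D : Mat n p} :
    sympInv U * D ∈ hamiltonian p ↔ Dᵀ * J n * U + Uᵀ * J n * D = 0 := by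
  change (J p * (sympInv U * D))ᵀ = J p * (sympInv U * D) ↔ _
  rw [sympInv_mul, Matrix.mul_neg, J_mul_J_mul, neg_neg, Matrix.transpose_mul,
    Matrix.transpose_mul, J_transpose, Matrix.transpose_transpose, Matrix.neg_mul, Matrix.mul_neg,
    ← Matrix.mul_assoc, neg_eq_iff_add_eq_zero]

theorem transpose_mul_J_mul_transpose (U : Mat n p) :
    (Uᵀ * J n * U)ᵀ = -(Uᵀ * J n * U) := by
  simp only [Matrix.transpose_mul, J_transpose, Matrix.transpose_transpose, Matrix.neg_mul,
    Matrix.mul_neg, Matrix.mul_assoc]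

/-- For skew-symmetric `k` the matrix `-k J` is self-adjoint for the symplectic inverse. The same
holds for its principal square root `S`, since `J⁻¹ Sᵀ J` is another principal square root. -/
theorem IsPrincipalSqrt.transpose_mul_J {k S : Mat p p} (hk : kᵀ = -k)
    (h : IsPrincipalSqrt (-(k * J p)) S) : J p * Sᵀ = S * J p := by
  have hS : IsPrincipalSqrt (-(k * J p)) (-(J p * Sᵀ * J p)) := by
    refine isPrincipalSqrt_iff.2 ⟨?_, ?_⟩
    · have h1 : Sᵀ * Sᵀ = -(J p * k) := by
        rw [← Matrix.transpose_mul, h.1, Matrix.transpose_neg, Matrix.transpose_mul, hk,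
          J_transpose, neg_mul_neg]
      calc -(J p * Sᵀ * J p) * -(J p * Sᵀ * J p)
          = J p * (Sᵀ * (J p * (J p * (Sᵀ * J p)))) := by
            rw [neg_mul_neg]; simp only [Matrix.mul_assoc]
        _ = -(J p * (Sᵀ * Sᵀ * J p)) := by
            rw [J_mul_J_mul, Matrix.mul_neg, Matrix.mul_neg, Matrix.mul_assoc]
        _ = -(k * J p) := by
            rw [h1, Matrix.neg_mul, Matrix.mul_neg, neg_neg, Matrix.mul_assoc, J_mul_J_mul]
    · have hcp : (-(J p * Sᵀ * J p)).charpoly = S.charpoly := by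
        rw [Matrix.mul_assoc, ← Matrix.mul_neg, Matrix.charpoly_mul_comm, ← Matrix.mul_neg,
          ← Matrix.charpoly_transpose S, Matrix.mul_assoc, Matrix.neg_mul, J_mul_J, neg_neg,
          Matrix.mul_one]
      rw [spectrum_complexify_eq_of_charpoly_eq hcp]
      exact h.2
  have h2 := congrArg (· * J p) (h.unique hS)
  simp only [Matrix.neg_mul, Matrix.mul_assoc, J_mul_J, Matrix.mul_neg, Matrix.mul_one,
    neg_neg] at h2
  exact h2.symm

/-- `R^f_U(D)` is a symplectic frame: `Rᵀ J R = S⁻¹ K S⁻ᵀ` with `S = (-K J)^{1/2}`, and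
`S J Sᵀ = S² J = K`. -/
theorem Rf_mem_SpSt {U D : Mat n p} (hA : ∀ r ∈ spectrum ℝ (-(K U D * J p)), 0 < r) :
    Rf U D ∈ SpSt n p := by
  have hS := isPrincipalSqrt_principalSqrt hA
  have hcomm := hS.transpose_mul_J (transpose_mul_J_mul_transpose (Delta U D))
  rw [mem_SpSt_iff, Rf, Gf]
  have hdet := (Matrix.isUnit_iff_isUnit_det _).1 hS.isUnit
  have hsq := hS.1
  set S := principalSqrt (-(K U D * J p))
  have hK : K U D = S * J p * Sᵀ := by
    rw [Matrix.mul_assoc, hcomm, ← Matrix.mul_assoc, hsq, Matrix.neg_mul, Matrix.mul_assoc,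
      J_mul_J, Matrix.mul_neg, Matrix.mul_one, neg_neg]
  calc (Delta U D * S⁻¹ᵀ)ᵀ * J n * (Delta U D * S⁻¹ᵀ)
      = S⁻¹ * K U D * S⁻¹ᵀ := by
        simp only [K, Matrix.transpose_mul, Matrix.transpose_transpose, Matrix.mul_assoc]
    _ = S⁻¹ * S * J p * (S⁻¹ * S)ᵀ := by
        rw [hK]; simp only [Matrix.transpose_mul, Matrix.mul_assoc]
    _ = J p := by
        rw [Matrix.nonsing_inv_mul S hdet, Matrix.transpose_one, Matrix.one_mul, Matrix.mul_one]

theorem Delta_zero (U : Mat n p) : Delta U 0 = U := by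
  simp [Delta, NormedSpace.exp_zero]

theorem neg_K_mul_J_zero {U : Mat n p} (hU : U ∈ SpSt n p) : -(K U 0 * J p) = 1 := by
  rw [K, Delta_zero, mem_SpSt_iff.1 hU, J_mul_J, neg_neg]

theorem spectrum_one_pos : ∀ r ∈ spectrum ℝ (1 : Mat p p), 0 < r := by
  intro r hr
  by_contra h
  refine hr ((Matrix.isUnit_iff_isUnit_det _).2 ?_)
  have h1 : algebraMap ℝ (Mat p p) r - 1 = (r - 1) • (1 : Mat p p) := by
    rw [Algebra.algebraMap_eq_smul_one, sub_smul, one_smul]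
  rw [h1, Matrix.det_smul, Matrix.det_one, mul_one, isUnit_iff_ne_zero]
  exact pow_ne_zero _ (by linarith)

theorem isPrincipalSqrt_one : IsPrincipalSqrt (1 : Mat p p) 1 := by
  refine isPrincipalSqrt_iff.2 ⟨one_mul 1, fun z hz => ?_⟩
  cases isEmpty_or_nonempty (Fin p ⊕ Fin p)
  · simp [spectrum.of_subsingleton] at hz
  · rw [map_one, spectrum.one_eq] at hz
    simp [Set.mem_singleton_iff.1 hz]

theorem Gf_zero {U : Mat n p} (hU : U ∈ SpSt n p) : Gf U 0 = 1 := by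
  rw [Gf, neg_K_mul_J_zero hU, isPrincipalSqrt_one.principalSqrt_eq, inv_one,
    Matrix.transpose_one]

theorem Rf_zero {U : Mat n p} (hU : U ∈ SpSt n p) : Rf U 0 = U := by
  rw [Rf, Gf_zero hU, Delta_zero, Matrix.mul_one]

end SymplecticAlgebra

/-! ### Directional derivatives -/

section DirectionalDerivatives

variable {E F : Type*} [NormedAddCommGroup E] [NormedSpace ℝ E]
  [NormedAddCommGroup F] [NormedSpace ℝ F]

theorem hasDerivAt_smul (v : E) : HasDerivAt (fun t : ℝ => t • v) v 0 := by
  simpa using (hasDerivAt_id (0 : ℝ)).smul_const v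

theorem hasDerivAt_add_smul (x v : E) : HasDerivAt (fun t : ℝ => x + t • v) v 0 :=
  (hasDerivAt_smul v).const_add x

theorem fderiv_apply_eq_of_hasDerivAt {f : E → F} {x v : E} {w : F} (hf : DifferentiableAt ℝ f x)
    (h : HasDerivAt (fun t : ℝ => f (x + t • v)) w 0) : fderiv ℝ f x v = w := by
  rw [← hf.lineDeriv_eq_fderiv]
  exact HasLineDerivAt.lineDeriv h

/-- The ambient differential of `f` at `0` need not be the identity. If it fixes the elements of
`s`, then the differential within `s` is the identity, as only increments in `s` enter it. -/
theorem hasFDerivWithinAt_id_of_hasDerivAt {f : E → E} {s : Set E} (hf : DifferentiableAt ℝ f 0)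
    (h : ∀ v ∈ s, HasDerivAt (fun t : ℝ => f (t • v)) v 0) :
    HasFDerivWithinAt f (ContinuousLinearMap.id ℝ E) s 0 := by
  have h1 := hf.hasFDerivAt.hasFDerivWithinAt (s := s)
  rw [hasFDerivWithinAt_iff_isLittleO] at h1 ⊢
  refine h1.congr' ?_ Filter.EventuallyEq.rfl
  filter_upwards [self_mem_nhdsWithin] with v hv
  rw [sub_zero, fderiv_apply_eq_of_hasDerivAt hf (by simpa only [zero_add] using h v hv),
    ContinuousLinearMap.id_apply]

end DirectionalDerivatives

/-! ### Smoothness of the retraction and its velocity at zero -/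

section Calculus

variable {n p : ℕ}

theorem _root_.HasDerivAt.matrix_mul {l m k : Type*} [Fintype l] [Fintype m] [Fintype k]
    {f : ℝ → Matrix l m ℝ} {g : ℝ → Matrix m k ℝ} {f' : Matrix l m ℝ} {g' : Matrix m k ℝ} {t : ℝ}
    (hf : HasDerivAt f f' t) (hg : HasDerivAt g g' t) :
    HasDerivAt (fun s => f s * g s) (f t * g' + f' * g t) t :=
  (mulBilin l m k).hasDerivAt_of_bilinear (fun _ => hf) (fun _ => hg)

theorem _root_.HasDerivAt.matrix_transpose {m k : Type*} [Fintype m] [Fintype k]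
    {f : ℝ → Matrix m k ℝ} {f' : Matrix m k ℝ} {t : ℝ} (hf : HasDerivAt f f' t) :
    HasDerivAt (fun s => (f s)ᵀ) f'ᵀ t :=
  (Matrix.transposeLinearEquiv m k ℝ ℝ).toLinearMap.toContinuousLinearMap.hasFDerivAt.comp_hasDerivAt
    t hf

theorem hasDerivAt_transpose_mul_J_mul {c : ℝ → Mat n p} {v : Mat n p} {t : ℝ}
    (hc : HasDerivAt c v t) :
    HasDerivAt (fun s => (c s)ᵀ * J n * c s) (vᵀ * J n * c t + (c t)ᵀ * J n * v) t := by
  convert (hc.matrix_transpose.matrix_mul (hasDerivAt_const t (J n))).matrix_mul hc using 1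
  rw [Matrix.mul_zero, zero_add, add_comm]

theorem contDiffAt_transpose_mul_J_mul {E : Type*} [NormedAddCommGroup E] [NormedSpace ℝ E]
    {f : E → Mat n p} {x : E} (hf : ContDiffAt ℝ ∞ f x) :
    ContDiffAt ℝ ∞ (fun y => (f y)ᵀ * J n * f y) x :=
  ((contDiff_transpose.contDiffAt.comp x hf).matrix_mul contDiffAt_const).matrix_mul hf

theorem contDiff_Delta : ContDiff ℝ ∞ fun q : Mat n p × Mat n p => Delta q.1 q.2 := by
  refine contDiff_iff_contDiffAt.2 fun q => ?_
  have h1 : ContDiffAt ℝ ∞ (fun q : Mat n p × Mat n p => q.1) q := contDiffAt_fst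
  have h2 : ContDiffAt ℝ ∞ (fun q : Mat n p × Mat n p => q.2) q := contDiffAt_snd
  have h3 : ContDiffAt ℝ ∞ (fun q : Mat n p × Mat n p => sympInv q.1) q :=
    (contDiffAt_const.matrix_mul (contDiff_transpose.contDiffAt.comp q h1)).matrix_mul
      contDiffAt_const
  exact (h1.matrix_mul (contDiff_exp.contDiffAt.comp q (h3.matrix_mul h2))).add
    ((contDiffAt_const.sub (h1.matrix_mul h3)).matrix_mul h2)

theorem contDiff_neg_K_mul_J :
    ContDiff ℝ ∞ fun q : Mat n p × Mat n p => -(K q.1 q.2 * J p) :=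
  contDiff_iff_contDiffAt.2 fun _ =>
    ((contDiffAt_transpose_mul_J_mul contDiff_Delta.contDiffAt).matrix_mul contDiffAt_const).neg

variable (n p) in
/-- The open set of all pairs `(U, D)` of matrices for which `-K J` has no eigenvalue in
`(-∞, 0]`. -/
def ambientDomain : Set (Mat n p × Mat n p) :=
  {q | ∀ r ∈ spectrum ℝ (-(K q.1 q.2 * J p)), 0 < r}

theorem isOpen_ambientDomain : IsOpen (ambientDomain n p) :=
  isOpen_setOf_spectrum_pos.preimage contDiff_neg_K_mul_J.continuous

theorem mk_zero_mem_ambientDomain {U : Mat n p} (hU : U ∈ SpSt n p) :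
    (U, (0 : Mat n p)) ∈ ambientDomain n p := by
  change ∀ r ∈ spectrum ℝ (-(K U 0 * J p)), 0 < r
  rw [neg_K_mul_J_zero hU]
  exact spectrum_one_pos

theorem contDiffAt_Rf {q : Mat n p × Mat n p} (hq : q ∈ ambientDomain n p) :
    ContDiffAt ℝ ∞ (fun q : Mat n p × Mat n p => Rf q.1 q.2) q :=
  contDiff_Delta.contDiffAt.matrix_mul
    (ContDiffAt.comp q (g := fun B : Mat p p => ((principalSqrt B)⁻¹)ᵀ)
      (contDiffAt_transpose_inv_principalSqrt hq) contDiff_neg_K_mul_J.contDiffAt)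

theorem hasDerivAt_Delta (U D : Mat n p) :
    HasDerivAt (fun t : ℝ => Delta U (t • D)) D 0 := by
  have h0 : HasDerivAt (fun t : ℝ => t • D) D 0 :=
    hasDerivAt_smul D
  have h1 := (hasDerivAt_const (0 : ℝ) (sympInv U)).matrix_mul h0
  have h2 : HasDerivAt (fun t : ℝ => NormedSpace.exp (sympInv U * (t • D))) (sympInv U * D) 0 := by
    have hexp : HasFDerivAt NormedSpace.exp (ContinuousLinearMap.id ℝ (Mat p p))
        (sympInv U * ((0 : ℝ) • D)) := by
      rw [zero_smul, Matrix.mul_zero]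
      exact hasFDerivAt_matrix_exp_zero
    refine (hexp.comp_hasDerivAt (0 : ℝ) h1).congr_deriv ?_
    rw [Matrix.zero_mul, add_zero]
    rfl
  refine (((hasDerivAt_const (0 : ℝ) U).matrix_mul h2).add
    ((hasDerivAt_const (0 : ℝ) (1 - U * sympInv U)).matrix_mul h0)).congr_deriv ?_
  simp only [Matrix.zero_mul, add_zero, Matrix.sub_mul, Matrix.one_mul, Matrix.mul_assoc]
  abel

/-- In tangential directions the differential of `D ↦ -K J` vanishes at `0`, so the correction
factor `G_f` does not contribute to the velocity. -/
theorem hasDerivAt_Rf {U D : Mat n p} (hU : U ∈ SpSt n p)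
    (hD : sympInv U * D ∈ hamiltonian p) : HasDerivAt (fun t : ℝ => Rf U (t • D)) D 0 := by
  have hΔ := hasDerivAt_Delta U D
  have hA : HasDerivAt (fun t : ℝ => -(K U (t • D) * J p)) 0 0 := by
    refine ((hasDerivAt_transpose_mul_J_mul hΔ).matrix_mul
      (hasDerivAt_const (0 : ℝ) (J p))).neg.congr_deriv ?_
    rw [zero_smul, Delta_zero, sympInv_mul_mem_hamiltonian_iff.1 hD]
    simp
  have hA0 : ∀ r ∈ spectrum ℝ (-(K U ((0 : ℝ) • D) * J p)), 0 < r := by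
    rw [zero_smul]
    exact mk_zero_mem_ambientDomain hU
  have hG : HasDerivAt (fun t : ℝ => Gf U (t • D)) 0 0 := by
    have h := ((contDiffAt_transpose_inv_principalSqrt hA0).differentiableAt
      (by simp)).hasFDerivAt.comp_hasDerivAt (0 : ℝ) hA
    rwa [map_zero] at h
  refine (hΔ.matrix_mul hG).congr_deriv ?_
  rw [zero_smul, Gf_zero hU, Matrix.mul_zero, zero_add, Matrix.mul_one]

end Calculus

/-! ### The submanifold structure and the retraction -/

section Manifold

variable {n p : ℕ}

/-- The tangent spaces are the kernels of the differential of `U ↦ Uᵀ J U`. Each element of such a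
kernel is the velocity of the curve `t ↦ R^f_U(t D)`. -/
theorem tangentSpaceAt_SpSt {U : Mat n p} (hU : U ∈ SpSt n p) :
    tangentSpaceAt (SpSt n p) U = {D | sympInv U * D ∈ hamiltonian p} := by
  ext D
  constructor
  · rintro ⟨c, ε, hε, -, hcM, rfl, hc⟩
    refine sympInv_mul_mem_hamiltonian_iff.2 ((hasDerivAt_transpose_mul_J_mul hc).unique ?_)
    refine (hasDerivAt_const (0 : ℝ) (J p)).congr_of_eventuallyEq ?_
    filter_upwards [Ioo_mem_nhds (neg_lt_zero.2 hε) hε] with t ht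
    exact mem_SpSt_iff.1 (hcM t ht)
  · intro hD
    have hline : ContDiff ℝ ∞ fun t : ℝ => (U, t • D) :=
      contDiff_const.prodMk (contDiff_id.smul contDiff_const)
    obtain ⟨ε, hε, hball⟩ := Metric.isOpen_iff.1
      (isOpen_ambientDomain.preimage hline.continuous) 0
        (by simpa using mk_zero_mem_ambientDomain hU)
    rw [Real.ball_eq_Ioo, zero_sub, zero_add] at hball
    refine ⟨fun t => Rf U (t • D), ε, hε, fun t ht => ?_, fun t ht => Rf_mem_SpSt (hball ht), ?_,
      hasDerivAt_Rf hU hD⟩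
    · exact ((contDiffAt_Rf (hball ht)).comp t hline.contDiffAt).contDiffWithinAt
    · simp only [zero_smul, Rf_zero hU]

/-- The space of skew-symmetric matrices of size `2p`. -/
def skewMatrices (p : ℕ) : Submodule ℝ (Mat p p) where
  carrier := {W | Wᵀ = -W}
  add_mem' {V W} hV hW := by
    simp only [Set.mem_ofPred_eq] at hV hW ⊢
    rw [Matrix.transpose_add, hV, hW, neg_add]
  zero_mem' := by simp
  smul_mem' r W hW := by
    simp only [Set.mem_ofPred_eq] at hW ⊢
    rw [Matrix.transpose_smul, hW, smul_neg]

/-- The projection `W ↦ (W - Wᵀ) / 2` onto the skew-symmetric matrices. -/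
noncomputable def skewPart (p : ℕ) : Mat p p →ₗ[ℝ] skewMatrices p :=
  LinearMap.codRestrict (skewMatrices p)
    ((1 / 2 : ℝ) • (LinearMap.id - (Matrix.transposeLinearEquiv _ _ ℝ ℝ).toLinearMap)) fun W => by
      change ((1 / 2 : ℝ) • (W - Wᵀ))ᵀ = -((1 / 2 : ℝ) • (W - Wᵀ))
      rw [Matrix.transpose_smul, Matrix.transpose_sub, Matrix.transpose_transpose, ← smul_neg,
        neg_sub]

theorem skewPart_apply_of_mem {W : Mat p p} (hW : W ∈ skewMatrices p) :
    skewPart p W = ⟨W, hW⟩ := by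
  refine Subtype.ext ?_
  change (1 / 2 : ℝ) • (W - Wᵀ) = W
  rw [show Wᵀ = -W from hW, sub_neg_eq_add, ← two_smul ℝ W, smul_smul]
  norm_num

/-- The defining function is `U ↦ Uᵀ J U - J`, with values in the skew-symmetric matrices. Its
differential at `U` maps `-U J W / 2` to `W`. -/
theorem isEmbeddedSubmanifold_SpSt : IsEmbeddedSubmanifold (SpSt n p) := by
  let e : skewMatrices p ≃L[ℝ] EuclideanSpace ℝ (Fin (Module.finrank ℝ (skewMatrices p))) :=
    ContinuousLinearEquiv.ofFinrankEq finrank_euclideanSpace_fin.symm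
  let P : Mat p p →L[ℝ] EuclideanSpace ℝ (Fin (Module.finrank ℝ (skewMatrices p))) :=
    e.toContinuousLinearMap ∘L (skewPart p).toContinuousLinearMap
  have hP : ∀ (W : Mat p p) (hW : W ∈ skewMatrices p), P W = e ⟨W, hW⟩ := fun W hW =>
    congrArg e (skewPart_apply_of_mem hW)
  have hskew : ∀ U : Mat n p, Uᵀ * J n * U - J p ∈ skewMatrices p := fun U =>
    sub_mem (transpose_mul_J_mul_transpose U) (J_transpose p)
  have hsm : ContDiff ℝ ∞ fun U : Mat n p => P (Uᵀ * J n * U - J p) :=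
    P.contDiff.comp ((contDiff_iff_contDiffAt.2 fun U =>
      contDiffAt_transpose_mul_J_mul contDiffAt_id).sub contDiff_const)
  refine ⟨_, fun U hU => ⟨Set.univ, fun U => P (Uᵀ * J n * U - J p), isOpen_univ, trivial,
    hsm.contDiffOn, fun y => ?_, fun V _ => ?_⟩⟩
  -- `Uᵀ J D = W / 2 = Dᵀ J U` for `D = -U J W / 2`, because `Uᵀ J U = J` and `J² = -1`.
  · set W : Mat p p := (e.symm y : Mat p p)
    have hW : Wᵀ = -W := (e.symm y).2
    set D : Mat n p := (-(1 / 2) : ℝ) • (U * (J p * W)) with hDdef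
    have h1 := P.hasFDerivAt.comp_hasDerivAt (0 : ℝ)
      ((hasDerivAt_transpose_mul_J_mul (hasDerivAt_add_smul U D)).sub_const (J p))
    have hdir : HasDerivAt (fun t : ℝ => P ((U + t • D)ᵀ * J n * (U + t • D) - J p)) y 0 := by
      refine HasDerivAt.congr_deriv h1 ?_
      rw [zero_smul, add_zero]
      have hUJ : Uᵀ * J n * D = (1 / 2 : ℝ) • W := by
        rw [hDdef, Matrix.mul_smul, ← Matrix.mul_assoc, mem_SpSt_iff.1 hU, J_mul_J_mul, smul_neg,
          neg_smul, neg_neg]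
      have hDJ : Dᵀ * J n * U = (1 / 2 : ℝ) • W := by
        have h2 : (Uᵀ * J n * D)ᵀ = -(Dᵀ * J n * U) := by
          simp only [Matrix.transpose_mul, J_transpose, Matrix.transpose_transpose, Matrix.neg_mul,
            Matrix.mul_neg, Matrix.mul_assoc]
        rw [hUJ, Matrix.transpose_smul, hW, smul_neg, neg_inj] at h2
        exact h2.symm
      rw [hUJ, hDJ, ← add_smul, show (1 / 2 + 1 / 2 : ℝ) = 1 by norm_num, one_smul]
      exact (hP W (e.symm y).2).trans (e.apply_symm_apply y)
    exact ⟨D, fderiv_apply_eq_of_hasDerivAt (hsm.differentiable (by simp) U) hdir⟩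
  -- The value of the defining function is itself skew-symmetric, so taking skew parts loses nothing.
  · have h0 : P (Vᵀ * J n * V - J p) = 0 ↔ Vᵀ * J n * V - J p = 0 :=
      (Eq.congr_left (hP _ (hskew V))).trans
        ((map_eq_zero_iff e e.injective).trans (Submodule.mk_eq_zero _ _))
    exact mem_SpSt_iff.trans (sub_eq_zero.symm.trans h0.symm)

theorem isRetractionOn_Rf : IsRetractionOn (SpSt n p) (domainRf n p) Rf where
  open_domain := ⟨ambientDomain n p, isOpen_ambientDomain, rfl⟩
  zero_mem U hU := ⟨⟨hU, by simp [tangentSpaceAt_SpSt hU, hamiltonian]⟩,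
    mk_zero_mem_ambientDomain hU⟩
  maps_to _ hq := Rf_mem_SpSt hq.2
  smooth _ hq := ⟨ambientDomain n p, fun q => Rf q.1 q.2, isOpen_ambientDomain, hq.2,
    fun _ hq' => (contDiffAt_Rf hq').contDiffWithinAt, fun _ _ => rfl⟩
  map_zero _ hU := Rf_zero hU
  differential_zero U hU := by
    have hdiff : DifferentiableAt ℝ (Rf U) 0 :=
      ((contDiffAt_Rf (mk_zero_mem_ambientDomain hU)).comp (0 : Mat n p)
        (contDiffAt_const.prodMk contDiffAt_id)).differentiableAt (by simp)
    refine hasFDerivWithinAt_id_of_hasDerivAt hdiff fun D hD => hasDerivAt_Rf hU ?_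
    rwa [tangentSpaceAt_SpSt hU] at hD

end Manifold

end SymplecticStiefel

theorem mainTheorem1 (n p : ℕ) :
    SymplecticStiefel.IsEmbeddedSubmanifold (SymplecticStiefel.SpSt n p) ∧
    (∀ U ∈ SymplecticStiefel.SpSt n p,
      SymplecticStiefel.tangentSpaceAt (SymplecticStiefel.SpSt n p) U =
        {D | SymplecticStiefel.sympInv U * D ∈ SymplecticStiefel.hamiltonian p}) ∧
    (∀ q ∈ SymplecticStiefel.domainRf n p, ∃! S : SymplecticStiefel.Mat p p,
      SymplecticStiefel.IsPrincipalSqrt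
        (-(SymplecticStiefel.K q.1 q.2 * SymplecticStiefel.J p)) S) ∧
    SymplecticStiefel.IsRetractionOn (SymplecticStiefel.SpSt n p)
      (SymplecticStiefel.domainRf n p) SymplecticStiefel.Rf :=
  ⟨SymplecticStiefel.isEmbeddedSubmanifold_SpSt,
    fun _ hU => SymplecticStiefel.tangentSpaceAt_SpSt hU,
    fun _ hq => ⟨_, SymplecticStiefel.isPrincipalSqrt_principalSqrt hq.2,
      fun _ hS => hS.unique (SymplecticStiefel.isPrincipalSqrt_principalSqrt hq.2)⟩,
    SymplecticStiefel.isRetractionOn_Rf⟩
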